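/- Let $(\mathfrak g,[\,,],\langle\,,\rangle)$ be a finite-dimensional real Lie algebra with a symmetric bilinear form of signature $(1,n-1)$ (one negative square). Let $\mathrm L$ be its Levi-Civita product, $2\langle \mathrm L_uv,w\rangle=\langle[u,v],w\rangle+\langle[w,u],v\rangle+\langle[w,v],u\rangle$, let $\mathrm K(u,v)=\mathrm L_{[u,v]}-[\mathrm L_u,\mathrm L_v]$, and let $\mathrm{Ric}$ be the Ricci operator, $\langle\mathrm{Ric}\,u,v\rangle=\mathrm{tr}(w\mapsto \mathrm K(u,w)v)$. The algebra has *harmonic curvature* if $\mathrm{Ric}$ is a Codazzi operator, that is, $\mathrm{Ric}$ is symmetric and, for all $u,v,w$, $\langle \mathrm L_uv,\mathrm{Ric}\,w\rangle+\langle \mathrm L_uw,\mathrm{Ric}\,v\rangle=\langle \mathrm L_vu,\mathrm{Ric}\,w\rangle+\langle \mathrm L_vw,\mathrm{Ric}\,u\rangle$; it is *Ricci-parallel* if $\mathrm L_u\circ\mathrm{Ric}=\mathrm{Ric}\circ \mathrm L_u$ for all $u$; a Euclidean Lie algebra is *$\alpha$-Einstein* if its Ricci operator is $\alpha\,\mathrm{Id}$.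 Assume that $\mathrm{Ric}$ is of type $\{n,a2\}$ with a single real eigenvalue $\alpha\neq a$ on its diagonal part: $\mathfrak g=\mathrm{span}(e,\bar e)\oplus\mathfrak h$ is an orthogonal direct sum, $\mathfrak h$ is a Euclidean subspace, $\langle e,e\rangle=\langle\bar e,\bar e\rangle=0$, $\langle e,\bar e\rangle=1$, and $$\mathrm{Ric}(e)=ae,\qquad \mathrm{Ric}(\bar e)=\varepsilon e+a\bar e,\qquad \mathrm{Ric}|_{\mathfrak h}=\alpha\,\mathrm{Id}_{\mathfrak h},\qquad \varepsilon\in\{1,-1\}.$$ Then $\mathfrak g$ has harmonic curvature if and only if $a=0$, $\alpha<0$, and the following condition $(\ast)$ holds for $(e,\bar e,\mathfrak h)$: $\mathrm{span}(e,\bar e)$ is an abelian ideal of $\mathfrak g$ on which the metric is Lorentzian, $\mathfrak h$ is a subalgebra which with the restricted metric is a Euclidean $\alpha$-Einstein Lie algebra, and there is a nonzero $X\in\mathfrak h$ with $X\perp[\mathfrak h,\mathfrak h]$ such that $$[e,u]=[\bar e,u]=0\ \text{ for all } u\in\mathfrak h \text{ with } u\perp X,\qquad [e,X]=|X|^2e,\qquad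 [\bar e,X]=-|X|^2\Big(\frac{2\varepsilon}{\alpha}e+\bar e\Big),$$ $$\alpha=-4|X|^2-2\,\mathrm{tr}(\mathrm{ad}^{\mathfrak h}_X),$$ where $|X|^2=\langle X,X\rangle$ and $\mathrm{ad}^{\mathfrak h}_X:\mathfrak h\to\mathfrak h$, $u\mapsto[X,u]$. Equivalently, $\mathfrak g$ has harmonic curvature if and only if $a=0$, $\alpha<0$, and $(\ast)$ holds for some orthogonal decomposition $\mathfrak g=\mathrm{span}(f,\bar f)\oplus\mathfrak k$ with $\langle f,f\rangle=\langle\bar f,\bar f\rangle=0$, $\langle f,\bar f\rangle=1$ and $\mathfrak k$ Euclidean, in place of $(e,\bar e,\mathfrak h)$. Moreover, $\mathfrak g$ is never Ricci-parallel. -/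

import Mathlib

noncomputable section

namespace LorentzLie

/-! ### Bilinear forms on finite-dimensional real vector spaces -/

section Forms

variable {V : Type*} [AddCommGroup V] [Module ℝ V]

/-- A symmetric positive definite form. -/
def IsEuclidean (B : LinearMap.BilinForm ℝ V) : Prop :=
  B.IsSymm ∧ ∀ x : V, x ≠ 0 → 0 < B x x

/-- A symmetric form of signature `(1, n - 1)`: there is a vector `t` of negative square such that
the form is positive definite on the hyperplane `t^⊥`. -/
def IsLorentzian (B : LinearMap.BilinForm ℝ V) : Prop :=
  B.IsSymm ∧ ∃ t : V, B t t < 0 ∧ ∀ x : V, B t x = 0 → x ≠ 0 → 0 < B x x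

lemma IsEuclidean.nondegenerate {B : LinearMap.BilinForm ℝ V} (hB : IsEuclidean B) :
    B.Nondegenerate := by
  constructor
  · intro x hx
    by_contra h
    exact absurd (hx x) (hB.2 x h).ne'
  · intro x hx
    by_contra h
    exact absurd (hx x) (hB.2 x h).ne'

lemma IsLorentzian.nondegenerate {B : LinearMap.BilinForm ℝ V} (hB : IsLorentzian B) :
    B.Nondegenerate := by
  obtain ⟨hs, t, ht, hpos⟩ := hB
  have key : ∀ x, (∀ y, B x y = 0) → x = 0 := by
    intro x hx
    by_contra h
    have h1 : B t x = 0 := by rw [← hx t]; exact hs.eq t x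
    exact absurd (hx x) (hpos x h1 h).ne'
  exact ⟨key, fun x hx => key x fun y => by rw [← hx y]; exact hs.eq x y⟩

open Classical in
/-- The vector `v` with `⟨v, w⟩ = φ w` for all `w`, where the form is nondegenerate (and `0`
otherwise; all the forms below are nondegenerate). -/
def sharp [FiniteDimensional ℝ V] (B : LinearMap.BilinForm ℝ V) : Module.Dual ℝ V →ₗ[ℝ] V :=
  if hB : B.Nondegenerate then (B.toDual hB).symm.toLinearMap else 0

lemma apply_sharp [FiniteDimensional ℝ V] {B : LinearMap.BilinForm ℝ V} (hB : B.Nondegenerate)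
    (φ : Module.Dual ℝ V) (w : V) : B (sharp B φ) w = φ w := by
  simp only [sharp, dif_pos hB]
  exact LinearMap.BilinForm.apply_toDual_symm_apply φ w

/-- `V` is the orthogonal direct sum of the plane `span(e, e')`, on which the form is Lorentzian
with the null basis `⟨e, e⟩ = ⟨e', e'⟩ = 0`, `⟨e, e'⟩ = 1`, and of the Euclidean subspace `h`. -/
structure IsNullSplitting (B : LinearMap.BilinForm ℝ V) (e e' : V) (h : Submodule ℝ V) : Prop where
  null_left : B e e = 0
  null_right : B e' e' = 0
  pairing : B e e' = 1
  isCompl : IsCompl (Submodule.span ℝ {e, e'}) h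
  orthogonal : ∀ u ∈ h, B e u = 0 ∧ B e' u = 0
  euclidean : IsEuclidean (B.restrict h)

/-- The operator `f` is of type `{n, a2}` with diagonal part `α • id`: in an orthonormal basis of
`h` completed by `(e, e')`, its matrix is `diag(α, …, α) ⊕ !![a, ε; 0, a]` with `ε = ± 1`. -/
structure IsTypeA2 (B : LinearMap.BilinForm ℝ V) (f : V →ₗ[ℝ] V) (a α ε : ℝ) (e e' : V)
    (h : Submodule ℝ V) : Prop extends IsNullSplitting B e e' h where
  sign : ε = 1 ∨ ε = -1
  map_left : f e = a • e
  map_right : f e' = ε • e + a • e'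
  map_diag : ∀ u ∈ h, f u = α • u

end Forms

/-! ### Levi-Civita product and curvature of a pseudo-Euclidean Lie algebra -/

section Curvature

variable {g : Type*} [LieRing g] [LieAlgebra ℝ g]

/-- Half of the right-hand side of Koszul's formula, as a linear form in `w`:
`(⟨[u, v], w⟩ + ⟨[w, u], v⟩ + ⟨[w, v], u⟩) / 2`. -/
def koszul (B : LinearMap.BilinForm ℝ g) (u v : g) : Module.Dual ℝ g where
  toFun w := (B ⁅u, v⁆ w + B ⁅w, u⁆ v + B ⁅w, v⁆ u) / 2
  map_add' x y := by simp only [add_lie, map_add, LinearMap.add_apply]; ring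
  map_smul' c x := by
    simp only [smul_lie, map_smul, LinearMap.smul_apply, smul_eq_mul, RingHom.id_apply]; ring

variable [FiniteDimensional ℝ g]

/-- The Levi-Civita product `L_u v`. -/
def leviCivita (B : LinearMap.BilinForm ℝ g) : g →ₗ[ℝ] Module.End ℝ g :=
  LinearMap.mk₂ ℝ (fun u v => sharp B (koszul B u v))
    (fun u u' v => by
      rw [← map_add]; congr 1; ext w
      simp only [koszul, LinearMap.coe_mk, AddHom.coe_mk, LinearMap.add_apply, add_lie, lie_add,
        map_add]
      ring)
    (fun c u v => by
      rw [← map_smul]; congr 1; ext w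
      simp only [koszul, LinearMap.coe_mk, AddHom.coe_mk, LinearMap.smul_apply, smul_lie, lie_smul,
        map_smul, smul_eq_mul]
      ring)
    (fun u v v' => by
      rw [← map_add]; congr 1; ext w
      simp only [koszul, LinearMap.coe_mk, AddHom.coe_mk, LinearMap.add_apply, lie_add, map_add]
      ring)
    (fun c u v => by
      rw [← map_smul]; congr 1; ext w
      simp only [koszul, LinearMap.coe_mk, AddHom.coe_mk, LinearMap.smul_apply, lie_smul,
        map_smul, smul_eq_mul]
      ring)

/-- Koszul's formula. -/
lemma two_mul_leviCivita {B : LinearMap.BilinForm ℝ g} (hB : B.Nondegenerate) (u v w : g) :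
    2 * B (leviCivita B u v) w = B ⁅u, v⁆ w + B ⁅w, u⁆ v + B ⁅w, v⁆ u := by
  have h : B (leviCivita B u v) w = koszul B u v w := apply_sharp hB _ _
  rw [h]
  simp only [koszul, LinearMap.coe_mk, AddHom.coe_mk]
  ring

/-- The curvature `K(u, v) = L_{[u, v]} - [L_u, L_v]`. -/
def curvature (B : LinearMap.BilinForm ℝ g) (u v : g) : Module.End ℝ g :=
  leviCivita B ⁅u, v⁆ - (leviCivita B u * leviCivita B v - leviCivita B v * leviCivita B u)

/-- The endomorphism `w ↦ K(u, w) v`. -/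
def curvatureEnd (B : LinearMap.BilinForm ℝ g) (u v : g) : Module.End ℝ g where
  toFun w := curvature B u w v
  map_add' x y := by
    simp only [curvature, lie_add, map_add, LinearMap.add_apply, LinearMap.sub_apply,
      Module.End.mul_apply]
    abel
  map_smul' c x := by
    simp only [curvature, lie_smul, map_smul, LinearMap.smul_apply, LinearMap.sub_apply,
      Module.End.mul_apply, RingHom.id_apply, smul_sub]

/-- The Ricci curvature `ric(u, v) = tr(w ↦ K(u, w) v)`. -/
def ricciForm (B : LinearMap.BilinForm ℝ g) : LinearMap.BilinForm ℝ g :=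
  LinearMap.mk₂ ℝ (fun u v => LinearMap.trace ℝ g (curvatureEnd B u v))
    (fun u u' v => by
      rw [← map_add]; congr 1; ext w
      simp only [curvatureEnd, curvature, LinearMap.coe_mk, AddHom.coe_mk, LinearMap.add_apply,
        add_lie, map_add, LinearMap.sub_apply, Module.End.mul_apply]
      abel)
    (fun c u v => by
      rw [← map_smul]; congr 1; ext w
      simp only [curvatureEnd, curvature, LinearMap.coe_mk, AddHom.coe_mk, LinearMap.smul_apply,
        smul_lie, map_smul, LinearMap.sub_apply, Module.End.mul_apply, smul_sub])
    (fun u v v' => by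
      rw [← map_add]; congr 1; ext w
      simp only [curvatureEnd, LinearMap.coe_mk, AddHom.coe_mk, LinearMap.add_apply, map_add])
    (fun c u v => by
      rw [← map_smul]; congr 1; ext w
      simp only [curvatureEnd, LinearMap.coe_mk, AddHom.coe_mk, LinearMap.smul_apply, map_smul])

/-- The Ricci operator: `⟨Ric u, v⟩ = ric(u, v)`. -/
def ricci (B : LinearMap.BilinForm ℝ g) : g →ₗ[ℝ] g := sharp B ∘ₗ ricciForm B

lemma apply_ricci {B : LinearMap.BilinForm ℝ g} (hB : B.Nondegenerate) (u v : g) :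
    B (ricci B u) v = ricciForm B u v := apply_sharp hB _ _

/-- A symmetric operator `A` such that the `(0, 2)`-tensor `⟨A ·, ·⟩` satisfies the Codazzi
equation. -/
def IsCodazzi (B : LinearMap.BilinForm ℝ g) (A : g →ₗ[ℝ] g) : Prop :=
  (∀ u v : g, B (A u) v = B u (A v)) ∧
    ∀ u v w : g, B (leviCivita B u v) (A w) + B (leviCivita B u w) (A v) =
      B (leviCivita B v u) (A w) + B (leviCivita B v w) (A u)

/-- Harmonic curvature: the Ricci operator is a Codazzi operator. -/
def HasHarmonicCurvature (B : LinearMap.BilinForm ℝ g) : Prop := IsCodazzi B (ricci B)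

/-- Parallel Ricci operator: `∇ Ric = 0`, i.e. `L_u (Ric v) = Ric (L_u v)`. -/
def IsRicciParallel (B : LinearMap.BilinForm ℝ g) : Prop :=
  ∀ u v : g, leviCivita B u (ricci B v) = ricci B (leviCivita B u v)

/-- `α`-Einstein: `Ric = α • id`. -/
def IsEinstein (B : LinearMap.BilinForm ℝ g) (α : ℝ) : Prop :=
  ricci B = α • LinearMap.id

/-- The restriction of the form to a Lie subalgebra. -/
def restrictForm (B : LinearMap.BilinForm ℝ g) (k : LieSubalgebra ℝ g) :
    LinearMap.BilinForm ℝ k :=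
  LinearMap.mk₂ ℝ (fun u v => B (u : g) (v : g))
    (fun _ _ _ => by simp) (fun _ _ _ => by simp) (fun _ _ _ => by simp) (fun _ _ _ => by simp)

/-- The explicit semidirect products: `g = span(e, e') ⊕ k` orthogonally, `span(e, e')` is an
abelian ideal on which the metric is Lorentzian, `k` is a Euclidean `α`-Einstein subalgebra, and
for a nonzero `X ∈ k` orthogonal to `[k, k]` the action of `k` on `span(e, e')` is the displayed
one. Here `ε` is the sign in the normal form of type `{n, a2}`. -/
structure IsA2Model (B : LinearMap.BilinForm ℝ g) (α ε : ℝ) (e e' : g) (k : LieSubalgebra ℝ g) :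
    Prop where
  splitting : IsNullSplitting B e e' k.toSubmodule
  ideal : ∃ I : LieIdeal ℝ g,
    LieSubmodule.toSubmodule I = Submodule.span ℝ {e, e'} ∧ IsLieAbelian I
  einstein : IsEinstein (restrictForm B k) α
  brackets : ∃ X : k, X ≠ 0 ∧ (∀ u v : k, restrictForm B k X ⁅u, v⁆ = 0) ∧
    (∀ u : k, restrictForm B k X u = 0 → ⁅e, (u : g)⁆ = 0 ∧ ⁅e', (u : g)⁆ = 0) ∧
    ⁅e, (X : g)⁆ = B X X • e ∧
    ⁅e', (X : g)⁆ = -(B X X • ((2 * ε / α) • e + e')) ∧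
    α = -4 * B X X - 2 * LinearMap.trace ℝ k (LieAlgebra.ad ℝ k X)

end Curvature

end LorentzLie

end

/-!
Write `L_u v = ∇_u v` for the Levi-Civita product and `c = 2ε / (α - a)`. Everything is computed in
the decomposition of `g` into the null plane `span(e, e')` and the Euclidean summand `h`.

*From harmonic curvature to the structure.* As `Ric - α` vanishes on `h` and is invertible on the
plane, the Codazzi equation makes `h` totally geodesic, hence a subalgebra, and determines enough of
the Levi-Civita product to give
`[e, v] = D v + ⟨X, v⟩ e`, `[e', v] = D' v - ⟨X, v⟩ (c e + e')`, `[e, e'] = -q e`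
for `v ∈ h`, with skew operators `D`, `D'` of `h` and a vector `X ∈ h`
(`IsTypeA2.exists_isNullSemidirect`). If `X = 0`, then `e'` spans a parallel line and
`ric(e', e') = 0`, while the normal form demands `ε`. So `X ≠ 0`, and the Jacobi identity gives
`D'X = qX`, so `q = 0` by skewness, then `[D, ad X] = |X|² D` and `[D', ad X] = -|X|² D'`; taking
traces against `D` and `D'` shows `D = D' = 0` (`IsNullSplitting.isNullSemidirect`). Thus `g` is a
null semidirect product (`IsNullSemidirect`).

*The curvature of a null semidirect product.* Koszul's formula gives `L_e = 0`,
`L_w e = -⟨X, w⟩ e`, `L_w e' = ⟨X, w⟩ e' + c ⟨e, w⟩ X`, and the Levi-Civita product of the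
subalgebra `k` on `k`. Therefore `ric(e, ·) = 0`, `ric(e', k) = 0`, `ric` restricts on `k` to the
Ricci form of `k`, and `ric(e', e') = -c (2 |X|² + tr ad_X)`. Comparison with the normal form yields
`a = 0`, the Einstein condition on `k` and the formula for `α`. Since `X` is orthogonal to `[k, k]`,
Milnor's inequality `ric(X, X) ≤ 0` (`IsEuclidean.ricciForm_self_nonpos`) gives `α < 0`.

*Converse and parallelism.* For `c = 2ε / α` the same formulas determine `Ric` on a null semidirect
product over any adapted decomposition, and the Codazzi equation becomes an identity
(`IsNullSemidirect.hasHarmonicCurvature`). A parallel symmetric operator is Codazzi, so a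
Ricci-parallel `g` would have the above structure, where `(∇_X Ric) e' = -2 ε |X|² e ≠ 0`.
-/

namespace LorentzLie

/-! ### Traces -/

section Traces

variable {V : Type*} [AddCommGroup V] [Module ℝ V]

lemma IsEuclidean.nonneg {B : LinearMap.BilinForm ℝ V} (hB : IsEuclidean B) (x : V) :
    0 ≤ B x x := by
  rcases eq_or_ne x 0 with rfl | hx
  · simp
  · exact (hB.2 x hx).le

variable [FiniteDimensional ℝ V]

lemma trace_eq_zero_of_skew {B : LinearMap.BilinForm ℝ V} (hB : B.Nondegenerate)
    {T : Module.End ℝ V} (hT : ∀ u v, B (T u) v = -B u (T v)) : LinearMap.trace ℝ V T = 0 := by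
  have h1 : (B.toDual hB).conj T = -(Module.Dual.transpose T) := by
    ext φ v
    obtain ⟨u, rfl⟩ := (B.toDual hB).surjective φ
    simp [LinearEquiv.conj_apply, LinearMap.BilinForm.toDual_def, hT, Module.Dual.transpose_apply]
  have h2 := LinearMap.trace_conj' T (B.toDual hB)
  have h3 := (LinearMap.trace ℝ (Module.Dual ℝ V)).map_neg (Module.Dual.transpose T)
  rw [LinearMap.trace_transpose'] at h3
  rw [h1, h3] at h2
  linarith

/-- A Euclidean form has an orthonormal basis, in which traces are computed by the form. -/
lemma IsEuclidean.exists_trace_eq_sum {B : LinearMap.BilinForm ℝ V} (hB : IsEuclidean B) :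
    ∃ (n : ℕ) (b : Module.Basis (Fin n) ℝ V),
      ∀ T : Module.End ℝ V, LinearMap.trace ℝ V T = ∑ i, B (T (b i)) (b i) := by
  let c : InnerProductSpace.Core ℝ V :=
    { inner := fun x y => B x y
      conj_inner_symm := fun x y => by simpa using hB.1.eq y x
      re_inner_nonneg := fun x => by
        rcases eq_or_ne x 0 with rfl | hx
        · simp
        · simpa using (hB.2 x hx).le
      add_left := fun x y z => by simp
      smul_left := fun x y r => by simp
      definite := fun x hx => by
        by_contra h
        exact (hB.2 x h).ne' hx }
  let _ : NormedAddCommGroup V := c.toNormedAddCommGroup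
  let _ : InnerProductSpace ℝ V := InnerProductSpace.ofCore c.toCore
  refine ⟨_, (stdOrthonormalBasis ℝ V).toBasis, fun T => ?_⟩
  rw [LinearMap.trace_eq_sum_inner T (stdOrthonormalBasis ℝ V)]
  refine Finset.sum_congr rfl fun i _ => ?_
  rw [OrthonormalBasis.coe_toBasis, hB.1.eq]
  rfl

lemma IsEuclidean.trace_mul_self_nonneg {B : LinearMap.BilinForm ℝ V} (hB : IsEuclidean B)
    {T : Module.End ℝ V} (hT : ∀ u v, B (T u) v = B u (T v)) :
    0 ≤ LinearMap.trace ℝ V (T * T) := by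
  obtain ⟨n, b, hb⟩ := hB.exists_trace_eq_sum
  rw [hb]
  refine Finset.sum_nonneg fun i _ => ?_
  rw [Module.End.mul_apply, hT]
  exact hB.nonneg _

lemma IsEuclidean.eq_zero_of_trace_mul_self {B : LinearMap.BilinForm ℝ V} (hB : IsEuclidean B)
    {T : Module.End ℝ V} (hT : ∀ u v, B (T u) v = -B u (T v))
    (h0 : LinearMap.trace ℝ V (T * T) = 0) : T = 0 := by
  obtain ⟨n, b, hb⟩ := hB.exists_trace_eq_sum
  have h1 : ∀ i, B ((T * T) (b i)) (b i) = -B (T (b i)) (T (b i)) := fun i => by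
    rw [Module.End.mul_apply, hT]
  simp only [hb, h1, Finset.sum_neg_distrib, neg_eq_zero] at h0
  rw [Finset.sum_eq_zero_iff_of_nonneg fun i _ => hB.nonneg _] at h0
  refine b.ext fun i => ?_
  by_contra h
  exact (hB.2 _ h).ne' (h0 i (Finset.mem_univ i))

/-- A skew operator `D` of a Euclidean space with `[D, A] = c D`, `c ≠ 0`, vanishes, because
`c tr(D²) = tr(D [D, A]) = 0`. -/
lemma IsEuclidean.eq_zero_of_commutator {B : LinearMap.BilinForm ℝ V} (hB : IsEuclidean B)
    {D A : Module.End ℝ V} (hD : ∀ u v, B (D u) v = -B u (D v)) {c : ℝ} (hc : c ≠ 0)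
    (h : D * A - A * D = c • D) : D = 0 := by
  refine hB.eq_zero_of_trace_mul_self hD ?_
  have h1 : LinearMap.trace ℝ V (D * (D * A - A * D)) = 0 := by
    rw [mul_sub, map_sub, LinearMap.trace_mul_comm ℝ D (D * A), mul_assoc, sub_self]
  rw [h, mul_smul_comm, map_smul, smul_eq_mul] at h1
  exact (mul_eq_zero.mp h1).resolve_left hc

end Traces

/-! ### Orthogonal splittings with a null plane -/

section Splitting

variable {V : Type*} [AddCommGroup V] [Module ℝ V] {B : LinearMap.BilinForm ℝ V} {e e' : V}
  {h : Submodule ℝ V}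

/-- The orthogonal projection onto the Euclidean summand. -/
noncomputable def IsNullSplitting.proj (H : IsNullSplitting B e e' h) : V →ₗ[ℝ] h :=
  h.projectionOnto _ H.isCompl.symm

lemma IsNullSplitting.proj_coe (H : IsNullSplitting B e e' h) (u : h) : H.proj u = u :=
  Submodule.projectionOnto_apply_left _ u

lemma IsNullSplitting.proj_left (H : IsNullSplitting B e e' h) : H.proj e = 0 :=
  Submodule.projectionOnto_apply_of_mem_right _ (Submodule.subset_span (by simp))

lemma IsNullSplitting.proj_right (H : IsNullSplitting B e e' h) : H.proj e' = 0 :=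
  Submodule.projectionOnto_apply_of_mem_right _ (Submodule.subset_span (by simp))

lemma IsNullSplitting.decomp (H : IsNullSplitting B e e' h) (hs : B.IsSymm) (x : V) :
    x = B e' x • e + B e x • e' + H.proj x := by
  have hx : x ∈ Submodule.span ℝ {e, e'} ⊔ h := by
    rw [H.isCompl.sup_eq_top]; trivial
  obtain ⟨y, hy, z, hz, rfl⟩ := Submodule.mem_sup.mp hx
  obtain ⟨s, t, rfl⟩ := Submodule.mem_span_pair.mp hy
  have h1 := H.proj_coe ⟨z, hz⟩
  simp only at h1
  have h2 : B e' e = 1 := by rw [hs.eq, H.pairing]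
  simp [H.null_left, H.null_right, H.pairing, h2, H.proj_left, H.proj_right,
    (H.orthogonal z hz).1, (H.orthogonal z hz).2, h1]

lemma IsNullSplitting.apply_proj (H : IsNullSplitting B e e' h) (hs : B.IsSymm) (x : V) {u : V}
    (hu : u ∈ h) : B (H.proj x) u = B x u := by
  conv_rhs => rw [H.decomp hs x]
  simp [(H.orthogonal u hu).1, (H.orthogonal u hu).2]

lemma IsNullSplitting.mem_iff (H : IsNullSplitting B e e' h) (hs : B.IsSymm) {x : V} :
    x ∈ h ↔ B e x = 0 ∧ B e' x = 0 := by
  refine ⟨H.orthogonal x, fun hx => ?_⟩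
  rw [H.decomp hs x, hx.1, hx.2]
  simp

lemma IsNullSplitting.pos (H : IsNullSplitting B e e' h) {x : V} (hx : x ∈ h) (h0 : x ≠ 0) :
    0 < B x x :=
  H.euclidean.2 ⟨x, hx⟩ (by simpa [Subtype.ext_iff] using h0)

/-- Vectors are determined by their products with the summands of the splitting. -/
lemma IsNullSplitting.ext (H : IsNullSplitting B e e' h) (hs : B.IsSymm) {x y : V}
    (h1 : B x e = B y e) (h2 : B x e' = B y e') (h3 : ∀ u ∈ h, B x u = B y u) : x = y := by
  rw [← sub_eq_zero]
  have hm : x - y ∈ h := by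
    rw [H.mem_iff hs, hs.eq, hs.eq e']
    simp [h1, h2]
  by_contra h0
  refine (H.pos hm h0).ne' ?_
  rw [LinearMap.map_sub₂, h3 _ hm, sub_self]

/-- The trace of an operator is the sum of the traces of its two diagonal blocks. -/
lemma IsNullSplitting.trace_eq [FiniteDimensional ℝ V] (H : IsNullSplitting B e e' h)
    (hs : B.IsSymm) (T : Module.End ℝ V) (S : Module.End ℝ h) (hTS : ∀ u : h, H.proj (T u) = S u) :
    LinearMap.trace ℝ V T = LinearMap.trace ℝ h S + B (T e) e' + B (T e') e := by
  have h1 : T = (T ∘ₗ h.subtype) ∘ₗ H.proj + (B e').smulRight (T e) + (B e).smulRight (T e') := by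
    ext x
    conv_lhs => rw [H.decomp hs x]
    simp only [map_add, map_smul, LinearMap.add_apply, LinearMap.comp_apply,
      LinearMap.smulRight_apply, Submodule.subtype_apply]
    abel
  have h2 : H.proj ∘ₗ (T ∘ₗ h.subtype) = S := by
    ext u
    simp [hTS]
  rw [h1, map_add, map_add, LinearMap.trace_smulRight, LinearMap.trace_smulRight,
    LinearMap.trace_comp_comm', h2, ← h1, hs.eq e', hs.eq e]

end Splitting

/-! ### The Levi-Civita product -/

section LeviCivita

variable {g : Type*} [LieRing g] [LieAlgebra ℝ g]

lemma apply_lie_comm (B : LinearMap.BilinForm ℝ g) (u v w : g) : B ⁅u, v⁆ w = -B ⁅v, u⁆ w := by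
  rw [← lie_skew, map_neg, LinearMap.neg_apply]

variable [FiniteDimensional ℝ g] {B : LinearMap.BilinForm ℝ g}

lemma leviCivita_skew (hB : B.Nondegenerate) (hs : B.IsSymm) (u v w : g) :
    B (leviCivita B u v) w = -B v (leviCivita B u w) := by
  have h1 := two_mul_leviCivita hB u v w
  have h2 := two_mul_leviCivita hB u w v
  have h3 := apply_lie_comm B w v u
  have h4 := apply_lie_comm B w u v
  have h5 := apply_lie_comm B v u w
  rw [hs.eq v]
  linarith

lemma leviCivita_sub_leviCivita (hB : B.Nondegenerate) (u v : g) :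
    leviCivita B u v - leviCivita B v u = ⁅u, v⁆ := by
  rw [← sub_eq_zero]
  refine hB.1 _ fun w => ?_
  have h1 := two_mul_leviCivita hB u v w
  have h2 := two_mul_leviCivita hB v u w
  have h5 := apply_lie_comm B v u w
  simp only [map_sub, LinearMap.sub_apply]
  linarith

lemma leviCivita_restrictForm (hB : B.Nondegenerate) {k : LieSubalgebra ℝ g}
    (hk : (restrictForm B k).Nondegenerate) (u v w : k) :
    B (leviCivita (restrictForm B k) u v) w = B (leviCivita B (u : g) (v : g)) w := by
  have h1 := two_mul_leviCivita hB (u : g) (v : g) (w : g)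
  have h2 := two_mul_leviCivita hk u v w
  simp only [restrictForm, LinearMap.mk₂_apply, LieSubalgebra.coe_bracket] at h2
  simp only [restrictForm] at *
  linarith

/-- The divergence of `X` is `-tr (ad X)`, as `∇_w X = ∇_X w - [X, w]` and `∇_X` is skew. -/
lemma trace_leviCivita_flip (hB : B.Nondegenerate) (hs : B.IsSymm) (X : g) :
    LinearMap.trace ℝ g ((leviCivita B).flip X) = -LinearMap.trace ℝ g (LieAlgebra.ad ℝ g X) := by
  have h1 : (leviCivita B).flip X = leviCivita B X - LieAlgebra.ad ℝ g X := by
    ext w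
    simp only [LinearMap.flip_apply, LinearMap.sub_apply, LieAlgebra.ad_apply,
      ← leviCivita_sub_leviCivita hB X w]
    abel
  rw [h1, map_sub, trace_eq_zero_of_skew hB (leviCivita_skew hB hs X), zero_sub]

lemma curvature_apply (u v w : g) : curvature B u v w = leviCivita B ⁅u, v⁆ w -
    (leviCivita B u (leviCivita B v w) - leviCivita B v (leviCivita B u w)) := rfl

lemma curvature_swap (u v w : g) : curvature B u v w = -curvature B v u w := by
  rw [curvature_apply, curvature_apply, ← lie_skew, map_neg, LinearMap.neg_apply]
  abel

lemma ricciForm_apply (u v : g) :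
    ricciForm B u v = LinearMap.trace ℝ g (curvatureEnd B u v) := rfl

lemma curvatureEnd_apply (u v w : g) : curvatureEnd B u v w = curvature B u w v := rfl

/-- Milnor's inequality: if `X` is orthogonal to the derived algebra, then `S w = -∇_w X` is the
symmetric part of `ad X` and `ric(X, X) = -tr(S²)`. -/
lemma IsEuclidean.ricciForm_self_nonpos (hB : IsEuclidean B) {X : g}
    (hX : ∀ u v : g, B X ⁅u, v⁆ = 0) : ricciForm B X X ≤ 0 := by
  have hn := hB.nondegenerate
  set S := (leviCivita B).flip X with hS
  have hsym : ∀ u v, B (S u) v = B u (S v) := fun u v => by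
    have h1 := two_mul_leviCivita hn u X v
    have h2 := two_mul_leviCivita hn v X u
    rw [hB.1.eq u]
    simp only [hS, LinearMap.flip_apply]
    rw [hB.1.eq _ X, hX] at h1 h2
    linarith
  have h0 : leviCivita B X X = 0 := hn.1 _ fun w => by
    have h1 := two_mul_leviCivita hn X X w
    rw [hB.1.eq _ X, hX, lie_self] at h1
    simp only [map_zero, LinearMap.zero_apply] at h1
    linarith
  have h1 : curvatureEnd B X X = S * leviCivita B X - S * S - leviCivita B X * S := by
    ext w
    simp only [curvatureEnd_apply, curvature_apply, h0, map_zero, LinearMap.sub_apply,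
      Module.End.mul_apply, hS, LinearMap.flip_apply, sub_zero,
      ← leviCivita_sub_leviCivita hn X w, map_sub]
  have h2 := hB.trace_mul_self_nonneg hsym
  rw [ricciForm_apply, h1, map_sub, map_sub, LinearMap.trace_mul_comm ℝ S]
  linarith

end LeviCivita

/-! ### Semidirect products of a Euclidean Lie algebra with a null plane -/

section Semidirect

variable {g : Type*} [LieRing g] [LieAlgebra ℝ g] {B : LinearMap.BilinForm ℝ g} {c : ℝ} {X e e' : g}
  {k : LieSubalgebra ℝ g}

/-- The Lie algebra `g` is an orthogonal semidirect product of the abelian null plane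
`span(e, e')` and of the Euclidean subalgebra `k`, and the action of `k` on the plane is
`[e, u] = ⟨X, u⟩ e`, `[e', u] = -⟨X, u⟩ (c e + e')`. -/
structure IsNullSemidirect (B : LinearMap.BilinForm ℝ g) (c : ℝ) (X e e' : g)
    (k : LieSubalgebra ℝ g) : Prop where
  splitting : IsNullSplitting B e e' k.toSubmodule
  mem : X ∈ k
  lie_null : ⁅e, e'⁆ = 0
  lie_left : ∀ u ∈ k, ⁅e, u⁆ = B X u • e
  lie_right : ∀ u ∈ k, ⁅e', u⁆ = -(B X u • (c • e + e'))

namespace IsNullSemidirect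

lemma apply_left (H : IsNullSemidirect B c X e e' k) (hs : B.IsSymm) : B X e = 0 := by
  rw [hs.eq]; exact (H.splitting.orthogonal X H.mem).1

lemma apply_right (H : IsNullSemidirect B c X e e' k) (hs : B.IsSymm) : B X e' = 0 := by
  rw [hs.eq]; exact (H.splitting.orthogonal X H.mem).2

lemma pairing' (H : IsNullSemidirect B c X e e' k) (hs : B.IsSymm) : B e' e = 1 := by
  rw [hs.eq, H.splitting.pairing]

lemma apply_proj (H : IsNullSemidirect B c X e e' k) (hs : B.IsSymm) (u : g) :
    B X (H.splitting.proj u) = B X u := by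
  rw [hs.eq, H.splitting.apply_proj hs u H.mem, hs.eq]

lemma left_lie (H : IsNullSemidirect B c X e e' k) (hs : B.IsSymm) (u : g) :
    ⁅e, u⁆ = B X u • e := by
  conv_lhs => rw [H.splitting.decomp hs u]
  simp only [lie_add, lie_smul, lie_self, H.lie_null, H.lie_left _ (H.splitting.proj u).2,
    H.apply_proj hs, smul_zero, zero_add]

lemma right_lie (H : IsNullSemidirect B c X e e' k) (hs : B.IsSymm) (u : g) :
    ⁅e', u⁆ = -(B X u • (c • e + e')) := by
  have h1 : ⁅e', e⁆ = 0 := by rw [← lie_skew, H.lie_null, neg_zero]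
  conv_lhs => rw [H.splitting.decomp hs u]
  simp only [lie_add, lie_smul, lie_self, h1, H.lie_right _ (H.splitting.proj u).2,
    H.apply_proj hs, smul_zero, zero_add]

lemma lie_left' (H : IsNullSemidirect B c X e e' k) (hs : B.IsSymm) (u : g) :
    ⁅u, e⁆ = -(B X u • e) := by
  rw [← lie_skew, H.left_lie hs]

lemma lie_right' (H : IsNullSemidirect B c X e e' k) (hs : B.IsSymm) (u : g) :
    ⁅u, e'⁆ = B X u • (c • e + e') := by
  rw [← lie_skew, H.right_lie hs, neg_neg]

/-- The Jacobi identity for `e` shows that `X` is orthogonal to the derived algebra. -/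
lemma apply_lie (H : IsNullSemidirect B c X e e' k) (hs : B.IsSymm) (u v : g) :
    B X ⁅u, v⁆ = 0 := by
  have h1 := leibniz_lie e u v
  simp only [H.left_lie hs, smul_lie, lie_smul, H.lie_left' hs, smul_neg, smul_smul] at h1
  have h2 := congrArg (fun x => B x e') h1
  simp only [map_smul, map_add, map_neg, LinearMap.add_apply, LinearMap.smul_apply,
    LinearMap.neg_apply, H.splitting.pairing, smul_eq_mul] at h2
  linarith

lemma lie_apply_left (H : IsNullSemidirect B c X e e' k) (hs : B.IsSymm) (w u : g) :
    B ⁅w, u⁆ e = B e u * B X w - B e w * B X u := by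
  have h0 : B ⁅(H.splitting.proj w : g), (H.splitting.proj u : g)⁆ e = 0 := by
    rw [hs.eq]
    exact (H.splitting.orthogonal _ (k.lie_mem (H.splitting.proj w).2 (H.splitting.proj u).2)).1
  conv_lhs => rw [H.splitting.decomp hs u, H.splitting.decomp hs w]
  simp only [lie_add, add_lie, lie_smul, smul_lie, H.left_lie hs, H.right_lie hs, H.lie_left' hs,
    H.lie_right' hs, map_add, map_smul, map_neg, LinearMap.add_apply, LinearMap.smul_apply,
    LinearMap.neg_apply, h0, H.apply_left hs, H.apply_right hs, H.apply_proj hs,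
    H.splitting.null_left, H.pairing' hs, smul_eq_mul]
  ring

lemma lie_apply_right (H : IsNullSemidirect B c X e e' k) (hs : B.IsSymm) (w u : g) :
    B ⁅w, u⁆ e' = (B e' w - c * B e w) * B X u - (B e' u - c * B e u) * B X w := by
  have h0 : B ⁅(H.splitting.proj w : g), (H.splitting.proj u : g)⁆ e' = 0 := by
    rw [hs.eq]
    exact (H.splitting.orthogonal _ (k.lie_mem (H.splitting.proj w).2 (H.splitting.proj u).2)).2
  conv_lhs => rw [H.splitting.decomp hs u, H.splitting.decomp hs w]
  simp only [lie_add, add_lie, lie_smul, smul_lie, H.left_lie hs, H.right_lie hs, H.lie_left' hs,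
    H.lie_right' hs, map_add, map_smul, map_neg, LinearMap.add_apply, LinearMap.smul_apply,
    LinearMap.neg_apply, h0, H.apply_left hs, H.apply_right hs, H.apply_proj hs,
    H.splitting.null_right, H.splitting.pairing, smul_eq_mul]
  ring

lemma restrict_nondegenerate (H : IsNullSemidirect B c X e e' k) :
    (restrictForm B k).Nondegenerate :=
  IsEuclidean.nondegenerate (B := restrictForm B k) H.splitting.euclidean

variable [FiniteDimensional ℝ g]

lemma leviCivita_apply_left (H : IsNullSemidirect B c X e e' k) (hB : IsLorentzian B) (w : g) :
    leviCivita B w e = -(B X w • e) := by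
  have hs := hB.1
  rw [← sub_eq_zero]
  refine hB.nondegenerate.1 _ fun z => ?_
  have h1 := two_mul_leviCivita hB.nondegenerate w e z
  rw [H.lie_left' hs, H.lie_left' hs, H.lie_apply_left hs] at h1
  simp only [map_sub, map_smul, map_neg, LinearMap.sub_apply, LinearMap.smul_apply,
    LinearMap.neg_apply, smul_eq_mul] at h1 ⊢
  linarith

lemma leviCivita_apply_right (H : IsNullSemidirect B c X e e' k) (hB : IsLorentzian B) (w : g) :
    leviCivita B w e' = B X w • e' + (c * B e w) • X := by
  have hs := hB.1
  rw [← sub_eq_zero]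
  refine hB.nondegenerate.1 _ fun z => ?_
  have h1 := two_mul_leviCivita hB.nondegenerate w e' z
  rw [H.lie_right' hs, H.lie_right' hs, H.lie_apply_right hs] at h1
  simp only [map_sub, map_add, map_smul, LinearMap.sub_apply, LinearMap.smul_apply,
    LinearMap.add_apply, smul_eq_mul] at h1 ⊢
  linarith

lemma leviCivita_left (H : IsNullSemidirect B c X e e' k) (hB : IsLorentzian B) :
    leviCivita B e = 0 := by
  ext u
  have h1 := leviCivita_sub_leviCivita hB.nondegenerate e u
  rw [H.left_lie hB.1, H.leviCivita_apply_left hB] at h1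
  simpa using h1

lemma leviCivita_right (H : IsNullSemidirect B c X e e' k) (hB : IsLorentzian B) (u : g) :
    leviCivita B e' u = (c * B e u) • X - (c * B X u) • e := by
  have h1 := leviCivita_sub_leviCivita hB.nondegenerate e' u
  rw [H.right_lie hB.1, H.leviCivita_apply_right hB, sub_eq_iff_eq_add] at h1
  rw [h1]
  module

/-- The subalgebra `k` is totally geodesic. -/
lemma leviCivita_coe (H : IsNullSemidirect B c X e e' k) (hB : IsLorentzian B) (u v : k) :
    leviCivita B (u : g) (v : g) = (leviCivita (restrictForm B k) u v : k) := by
  have hs := hB.1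
  have hn := hB.nondegenerate
  have hu := H.splitting.orthogonal u u.2
  have hv := H.splitting.orthogonal v v.2
  have hL := H.splitting.orthogonal _ (leviCivita (restrictForm B k) u v).2
  refine H.splitting.ext hs ?_ ?_ fun w hw => ?_
  · rw [leviCivita_skew hn hs, H.leviCivita_apply_left hB, hs.eq _ e, hL.1, map_neg, map_smul,
      hs.eq _ e, hv.1]
    simp
  · rw [leviCivita_skew hn hs, H.leviCivita_apply_right hB, hs.eq _ e', hL.2, map_add, map_smul,
      hs.eq _ e', hv.2, hu.1]
    simp
  · exact (leviCivita_restrictForm hn H.restrict_nondegenerate u v ⟨w, hw⟩).symm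

/-! ### Their Ricci curvature -/

lemma curvature_left (H : IsNullSemidirect B c X e e' k) (hB : IsLorentzian B) (w : g) :
    curvature B e w = 0 := by
  simp [curvature, H.left_lie hB.1, H.leviCivita_left hB]

lemma ricciForm_left (H : IsNullSemidirect B c X e e' k) (hB : IsLorentzian B) (u : g) :
    ricciForm B e u = 0 := by
  have h1 : curvatureEnd B e u = 0 := by
    ext w
    simp [curvatureEnd_apply, H.curvature_left hB]
  rw [ricciForm_apply, h1, map_zero]

lemma trace_ad (H : IsNullSemidirect B c X e e' k) (hs : B.IsSymm) :
    LinearMap.trace ℝ g (LieAlgebra.ad ℝ g X) =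
      LinearMap.trace ℝ k (LieAlgebra.ad ℝ k ⟨X, H.mem⟩) := by
  have h1 := H.splitting.trace_eq hs (LieAlgebra.ad ℝ g X) (LieAlgebra.ad ℝ k ⟨X, H.mem⟩)
    fun u => H.splitting.proj_coe (⁅(⟨X, H.mem⟩ : k), (u : k)⁆ : k)
  rw [h1]
  simp only [LieAlgebra.ad_apply, H.lie_left' hs, H.lie_right' hs, map_add, map_smul, map_neg,
    LinearMap.add_apply, LinearMap.smul_apply, LinearMap.neg_apply, H.splitting.null_left,
    H.splitting.pairing, H.pairing' hs, smul_eq_mul]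
  change _ = LinearMap.trace ℝ k.toSubmodule _
  ring

lemma ricciForm_right_right (H : IsNullSemidirect B c X e e' k) (hB : IsLorentzian B) :
    ricciForm B e' e' =
      -(c * (2 * B X X + LinearMap.trace ℝ k (LieAlgebra.ad ℝ k ⟨X, H.mem⟩))) := by
  have hs := hB.1
  have h1 : curvatureEnd B e' e' = (-(2 * c)) • (B X).smulRight X +
      (c ^ 2 * B X X) • (B e).smulRight e + c • (leviCivita B).flip X := by
    ext w
    simp only [curvatureEnd_apply, curvature_apply, H.right_lie hs, map_neg, map_smul, map_add,
      LinearMap.neg_apply, LinearMap.smul_apply, LinearMap.add_apply, H.leviCivita_apply_right hB,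
      H.leviCivita_left hB, H.leviCivita_right hB, LinearMap.smulRight_apply,
      LinearMap.flip_apply, H.apply_right hs, H.splitting.pairing, LinearMap.zero_apply,
      hs.eq e X, H.apply_left hs]
    module
  rw [ricciForm_apply, h1, map_add, map_add, map_smul, map_smul, map_smul,
    LinearMap.trace_smulRight, LinearMap.trace_smulRight,
    trace_leviCivita_flip hB.nondegenerate hs, H.trace_ad hs, H.splitting.null_left]
  simp only [smul_eq_mul]
  ring

lemma curvature_right (H : IsNullSemidirect B c X e e' k) (hB : IsLorentzian B) (w : g) {v : g}
    (hv : v ∈ k) :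
    curvature B e' w v = (2 * c * B X v * B X w + c * B X (leviCivita B w v)) • e := by
  have hs := hB.1
  have h1 : B e (leviCivita B w v) = 0 := by
    have h2 := leviCivita_skew hB.nondegenerate hs w e v
    rw [H.leviCivita_apply_left hB, map_neg, map_smul, LinearMap.neg_apply, LinearMap.smul_apply,
      (H.splitting.orthogonal v hv).1, smul_zero, neg_zero] at h2
    linarith
  simp only [curvature_apply, H.right_lie hs, map_neg, map_smul, map_add, map_sub,
    LinearMap.neg_apply, LinearMap.smul_apply, LinearMap.add_apply, H.leviCivita_apply_left hB,
    H.leviCivita_left hB, H.leviCivita_right hB, LinearMap.zero_apply, h1,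
    (H.splitting.orthogonal v hv).1]
  module

lemma ricciForm_right_coe (H : IsNullSemidirect B c X e e' k) (hB : IsLorentzian B) {v : g}
    (hv : v ∈ k) : ricciForm B e' v = 0 := by
  have h1 : curvatureEnd B e' v =
      ((2 * c * B X v) • B X + c • (B X ∘ₗ (leviCivita B).flip v)).smulRight e := by
    ext w
    simp [curvatureEnd_apply, H.curvature_right hB w hv]
  rw [ricciForm_apply, h1, LinearMap.trace_smulRight]
  simp [H.apply_left hB.1, H.leviCivita_left hB]

lemma ricciForm_coe_coe (H : IsNullSemidirect B c X e e' k) (hB : IsLorentzian B) (u v : k) :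
    ricciForm B (u : g) (v : g) = ricciForm (restrictForm B k) u v := by
  have hs := hB.1
  have h1 := H.splitting.trace_eq hs (curvatureEnd B (u : g) (v : g))
    (curvatureEnd (restrictForm B k) u v) fun w => by
      have h2 : curvatureEnd B (u : g) (v : g) (w : g) =
          (curvatureEnd (restrictForm B k) u v w : k) := by
        have h3 := fun a b : k => H.leviCivita_coe hB a b
        simp only [curvatureEnd_apply, curvature_apply]
        simp only [AddSubgroupClass.coe_sub, ← h3, LieSubalgebra.coe_bracket]
      rw [h2]
      exact H.splitting.proj_coe _
  rw [ricciForm_apply, h1]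
  simp only [curvatureEnd_apply, curvature_swap (u : g), H.curvature_left hB,
    H.curvature_right hB _ v.2, map_neg, map_smul, LinearMap.neg_apply, LinearMap.smul_apply,
    LinearMap.zero_apply, map_zero, H.splitting.null_left, smul_zero, neg_zero, add_zero]
  rfl

end IsNullSemidirect

end Semidirect

/-! ### Codazzi operators of type `{n, a2}` -/

section Codazzi

variable {g : Type*} [LieRing g] [LieAlgebra ℝ g] [FiniteDimensional ℝ g]
  {B : LinearMap.BilinForm ℝ g} {A : g →ₗ[ℝ] g} {a α ε : ℝ} {e e' : g} {h : Submodule ℝ g}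

namespace IsTypeA2

lemma map_symm {V : Type*} [AddCommGroup V] [Module ℝ V] {B : LinearMap.BilinForm ℝ V}
    {A : V →ₗ[ℝ] V} {e e' : V} {h : Submodule ℝ V} (hA : IsTypeA2 B A a α ε e e' h)
    (hs : B.IsSymm) (u v : V) : B (A u) v = B u (A v) := by
  have H := hA.toIsNullSplitting
  have hp : B e' e = 1 := by rw [hs.eq, H.pairing]
  have h1 := fun u : h => H.orthogonal u u.2
  have h2 : ∀ u : h, B (u : V) e = 0 ∧ B (u : V) e' = 0 := fun u => by
    rw [hs.eq, hs.eq _ e']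
    exact h1 u
  rw [H.decomp hs u, H.decomp hs v]
  generalize H.proj u = u', H.proj v = v'
  simp only [map_add, map_smul, LinearMap.add_apply, LinearMap.smul_apply, hA.map_left,
    hA.map_right, hA.map_diag _ u'.2, hA.map_diag _ v'.2, H.null_left, H.null_right, H.pairing, hp,
    h1, h2, smul_eq_mul]
  ring

/-- The orthogonal complement of the null plane is totally geodesic. -/
lemma leviCivita_mem (hA : IsTypeA2 B A a α ε e e' h) (hC : IsCodazzi B A) (hB : IsLorentzian B)
    (hα : α ≠ a) {v w : g} (hv : v ∈ h) (hw : w ∈ h) : leviCivita B v w ∈ h := by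
  have hs := hB.1
  have sk := leviCivita_skew hB.nondegenerate hs
  -- `w ↦ L_z w` is skew and `A = α` on `h`, so the Codazzi equation says that `A - α` kills the
  -- null component of `L_v w`
  have key : ∀ z, B (A z) (leviCivita B v w) = α * B z (leviCivita B v w) := fun z => by
    have h1 := hC.2 z v w
    rw [hA.map_diag v hv, hA.map_diag w hw, sk z v, sk v z, hs.eq _ (A z)] at h1
    simp only [map_smul, smul_eq_mul] at h1
    rw [hs.eq v] at h1
    linarith
  rw [hA.mem_iff hs]
  have h1 := key e
  have h2 := key e'
  rw [hA.map_left] at h1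
  rw [hA.map_right] at h2
  simp only [map_add, map_smul, LinearMap.add_apply, LinearMap.smul_apply, smul_eq_mul] at h1 h2
  have h3 : B e (leviCivita B v w) = 0 :=
    (mul_eq_zero.mp (by linear_combination -h1 :
      (α - a) * B e (leviCivita B v w) = 0)).resolve_left (sub_ne_zero.mpr hα)
  refine ⟨h3, (mul_eq_zero.mp (?_ : (α - a) * B e' (leviCivita B v w) = 0)).resolve_left
    (sub_ne_zero.mpr hα)⟩
  rw [h3] at h2
  linarith

/-- The components of the Levi-Civita product on the null plane that the Codazzi equation
determines. -/
lemma leviCivita_null (hA : IsTypeA2 B A a α ε e e' h) (hC : IsCodazzi B A) (hB : IsLorentzian B)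
    (hα : α ≠ a) {v : g} (hv : v ∈ h) :
    B (leviCivita B e e) v = 0 ∧ B (leviCivita B e' e) v = 0 ∧ B (leviCivita B e e') v = 0 ∧
      (α - a) * B (leviCivita B e' e') v = 2 * ε * B (leviCivita B v e') e := by
  have hs := hB.1
  have sk := leviCivita_skew hB.nondegenerate hs
  have sk0 : ∀ u v, B (leviCivita B u v) v = 0 := fun u v => by
    have := sk u v v
    rw [hs.eq v] at this
    linarith
  have hα' := sub_ne_zero.mpr hα
  have h1 := hC.2 e v e
  have h2 := hC.2 e' v e
  have h3 := hC.2 e v e'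
  have h4 := hC.2 e' v e'
  simp only [hA.map_left, hA.map_right, hA.map_diag v hv, map_add, map_smul, smul_eq_mul,
    sk0] at h1 h2 h3 h4
  have s1 := sk v e e'
  have s2 := sk e v e
  have s3 := sk e' v e
  have s4 := sk e v e'
  have s5 := sk e' v e'
  rw [hs.eq e] at s1
  rw [hs.eq v] at s2 s3 s4 s5
  have r1 : B (leviCivita B e e) v = 0 :=
    (mul_eq_zero.mp (by linear_combination h1 - a * s2)).resolve_left hα'
  have r2 : B (leviCivita B e' e) v = 0 :=
    (mul_eq_zero.mp (by linear_combination h2 + a * s1 - a * s3)).resolve_left hα'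
  refine ⟨r1, r2, (mul_eq_zero.mp ?_).resolve_left hα', ?_⟩
  · linear_combination h3 + a * s1 - ε * s2 - a * s4 + ε * r1
  · linear_combination h4 - ε * s3 - a * s5 + ε * r2

lemma leviCivita_left_left (hA : IsTypeA2 B A a α ε e e' h) (hC : IsCodazzi B A)
    (hB : IsLorentzian B) : B (leviCivita B e e') e = 0 := by
  have hs := hB.1
  have sk := leviCivita_skew hB.nondegenerate hs
  have h1 := hC.2 e e' e'
  have h2 := sk e e' e'
  have h3 := sk e' e e
  have h4 := sk e' e e'
  rw [hs.eq e'] at h2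
  rw [hs.eq e] at h3 h4
  simp only [hA.map_left, hA.map_right, map_add, map_smul, smul_eq_mul] at h1
  have h5 : ε ≠ 0 := by rcases hA.sign with h | h <;> rw [h] <;> norm_num
  refine (mul_eq_zero.mp (?_ : ε * _ = 0)).resolve_left h5
  linear_combination h1 / 2 - a * h2 / 2 + a * h4 / 2 + ε * h3 / 4

end IsTypeA2

/-- If `e'` spans a parallel line, then `ric(e', e') = 0`. -/
lemma ricciForm_self_of_recurrent {φ : Module.Dual ℝ g}
    (hφ : ∀ w, leviCivita B w e' = φ w • e') : ricciForm B e' e' = 0 := by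
  have h1 : curvatureEnd B e' e' = (φ ∘ₗ (LieAlgebra.ad ℝ g e' : g →ₗ[ℝ] g)).smulRight e' := by
    ext w
    simp only [curvatureEnd_apply, curvature_apply, hφ, map_smul, LinearMap.smulRight_apply,
      LinearMap.comp_apply, LieAlgebra.ad_apply]
    module
  rw [ricciForm_apply, h1, LinearMap.trace_smulRight]
  simp

end Codazzi

/-! ### The Jacobi identity for the action on the null plane -/

section Rigidity

variable {g : Type*} [LieRing g] [LieAlgebra ℝ g] [FiniteDimensional ℝ g]
  {B : LinearMap.BilinForm ℝ g} {c q : ℝ} {X e e' : g} {k : LieSubalgebra ℝ g}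

/-- Suppose that `ad e` and `ad e'` act on `k`, modulo the null plane, by skew operators `D` and
`D'`. The Jacobi identity forces `D'X = qX`, hence `q = 0` and `DX = D'X = 0`, and then the
commutation relations `[D, ad X] = |X|² D` and `[D', ad X] = -|X|² D'`, whence `D = D' = 0`. -/
lemma IsNullSplitting.isNullSemidirect (H : IsNullSplitting B e e' k.toSubmodule) (hs : B.IsSymm)
    (X : k) (hX : X ≠ 0) {D D' : Module.End ℝ k}
    (hD : ∀ v : k, ⁅e, (v : g)⁆ = (D v : g) + B X v • e)
    (hD' : ∀ v : k, ⁅e', (v : g)⁆ = (D' v : g) - B X v • (c • e + e'))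
    (hq : ⁅e, e'⁆ = -(q • e)) (skD : ∀ u v : k, B (D u) v = -B (u : g) (D v))
    (skD' : ∀ u v : k, B (D' u) v = -B (u : g) (D' v)) : IsNullSemidirect B c X e e' k := by
  have hEu : IsEuclidean (restrictForm B k) := H.euclidean
  have hpos : B (X : g) X ≠ 0 := (hEu.2 X hX).ne'
  have hp : ∀ u : k, H.proj (u : g) = u := H.proj_coe
  have hpl : ∀ u v : k, H.proj ⁅(u : g), (v : g)⁆ = ⁅u, v⁆ := fun u v => H.proj_coe (⁅u, v⁆ : k)
  have hpe := H.proj_left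
  have hpe' := H.proj_right
  have hq' : ⁅e', e⁆ = q • e := by rw [← lie_skew, hq, neg_neg]
  have hDr : ∀ v : k, ⁅(v : g), e⁆ = -((D v : g) + B X v • e) := fun v => by
    rw [← lie_skew, hD]
  have hDr' : ∀ v : k, ⁅(v : g), e'⁆ = -((D' v : g) - B X v • (c • e + e')) := fun v => by
    rw [← lie_skew, hD']
  have ho : ∀ v : k, B (v : g) e = 0 ∧ B (v : g) e' = 0 := fun v => by
    rw [hs.eq, hs.eq _ e']
    exact H.orthogonal v v.2
  have hpair : B e' e = 1 := by rw [hs.eq, H.pairing]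
  have J : ∀ v : k, B X (D v) = 0 ∧ -(q * B X v) = B X (D' v) := fun v => by
    have h1 := leibniz_lie e e' (v : g)
    have h2 : ⁅e, ⁅e', (v : g)⁆⁆ = (D (D' v) : g) + B X (D' v) • e + (q * B X v) • e := by
      rw [hD', lie_sub, lie_smul, lie_add, lie_smul, lie_self, hq, hD]
      module
    have h3 : ⁅e', ⁅e, (v : g)⁆⁆ =
        (D' (D v) : g) - B X (D v) • (c • e + e') + (q * B X v) • e := by
      rw [hD, lie_add, lie_smul, hq', hD']
      module
    rw [h2, h3, hq, neg_lie, smul_lie, hD] at h1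
    have h4 := congrArg (fun x => B x e) h1
    have h5 := congrArg (fun x => B x e') h1
    simp only [map_add, map_sub, map_neg, map_smul, LinearMap.add_apply, LinearMap.sub_apply,
      LinearMap.neg_apply, LinearMap.smul_apply, smul_eq_mul, ho, H.null_left, H.null_right,
      hpair, H.pairing] at h4 h5
    have h6 : B X (D v) = 0 := by linear_combination h4
    refine ⟨h6, ?_⟩
    rw [h6] at h5
    linear_combination -h5
  have hq0 : q = 0 := by
    have h1 := (J X).2
    have h2 := skD' X X
    rw [hs.eq] at h2
    exact (mul_eq_zero.mp (by linarith : q * B (X : g) X = 0)).resolve_right hpos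
  have zero_of : ∀ {E : Module.End ℝ k}, (∀ u v : k, B (E u) v = -B (u : g) (E v)) →
      (∀ v : k, B (X : g) (E v) = 0) → E X = 0 := fun {E} sk hE => by
    by_contra h0
    refine (hEu.2 _ h0).ne' ?_
    change B (E X : g) (E X) = 0
    rw [sk, hE, neg_zero]
  have hDX : D X = 0 := zero_of skD fun v => (J v).1
  have hDX' : D' X = 0 := zero_of skD' fun v => by rw [← (J v).2, hq0, zero_mul, neg_zero]
  have comm : D * LieAlgebra.ad ℝ k X - LieAlgebra.ad ℝ k X * D = B (X : g) X • D := by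
    ext1 v
    have h1 := leibniz_lie e (X : g) (v : g)
    have h2 := hD ⁅X, v⁆
    rw [LieSubalgebra.coe_bracket] at h2
    rw [h2, hD X, hD v, hDX, ZeroMemClass.coe_zero, zero_add, smul_lie, lie_add, lie_smul, hDr X,
      hD v, hDX, ← LieSubalgebra.coe_bracket] at h1
    have h3 := congrArg H.proj h1
    simp only [map_add, map_smul, map_neg, hp, hpl, hpe, ZeroMemClass.coe_zero, smul_zero, add_zero,
      neg_zero, zero_add] at h3
    simp only [LinearMap.sub_apply, Module.End.mul_apply, LieAlgebra.ad_apply,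
      LinearMap.smul_apply]
    rw [h3]
    simp
  have hD0 : D = 0 := hEu.eq_zero_of_commutator skD hpos comm
  have comm' : D' * LieAlgebra.ad ℝ k X - LieAlgebra.ad ℝ k X * D' = (-B (X : g) X) • D' := by
    ext1 v
    have h1 := leibniz_lie e' (X : g) (v : g)
    have h2 := hD' ⁅X, v⁆
    rw [LieSubalgebra.coe_bracket] at h2
    rw [h2, hD' X, hD' v, hDX', ZeroMemClass.coe_zero, zero_sub, neg_lie, smul_lie, add_lie,
      smul_lie, lie_sub, lie_smul, lie_add, lie_smul, hDr X, hDr' X, hD v, hD' v, hDX', hD0,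
      ← LieSubalgebra.coe_bracket] at h1
    have h3 := congrArg H.proj h1
    simp only [map_add, map_sub, map_smul, map_neg, hp, hpl, hpe, hpe', ZeroMemClass.coe_zero,
      smul_zero, add_zero, neg_zero, zero_add, sub_zero, LinearMap.zero_apply, zero_sub] at h3
    simp only [LinearMap.sub_apply, Module.End.mul_apply, LieAlgebra.ad_apply,
      LinearMap.smul_apply]
    rw [h3]
    module
  have hD0' : D' = 0 := hEu.eq_zero_of_commutator skD' (neg_ne_zero.mpr hpos) comm'
  refine ⟨H, X.2, by simp [hq, hq0], fun u hu => ?_, fun u hu => ?_⟩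
  · simpa [hD0] using hD ⟨u, hu⟩
  · simpa [hD0'] using hD' ⟨u, hu⟩

end Rigidity

/-! ### Harmonic curvature and null semidirect products -/

section Equivalence

variable {g : Type*} [LieRing g] [LieAlgebra ℝ g] [FiniteDimensional ℝ g]
  {B : LinearMap.BilinForm ℝ g} {a α ε : ℝ} {e e' : g} {h : Submodule ℝ g}

/-- Harmonic curvature forces the null semidirect structure. The vector `X` represents the linear
form `v ↦ ⟨L_v e', e⟩`; it is nonzero since otherwise `e'` would span a parallel line, against
`ric(e', e') = ε`. -/
lemma IsTypeA2.exists_isNullSemidirect (hA : IsTypeA2 B (ricci B) a α ε e e' h)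
    (hC : HasHarmonicCurvature B) (hB : IsLorentzian B) (hα : α ≠ a) :
    ∃ (k : LieSubalgebra ℝ g) (X : k), k.toSubmodule = h ∧ X ≠ 0 ∧
      IsNullSemidirect B (2 * ε / (α - a)) X e e' k := by
  have hs := hB.1
  have hn := hB.nondegenerate
  have hα' := sub_ne_zero.mpr hα
  have sk := leviCivita_skew hn hs
  have sk0 : ∀ u v, B (leviCivita B u v) v = 0 := fun u v => by
    have := sk u v v
    rw [hs.eq v] at this
    linarith
  have tor := leviCivita_sub_leviCivita hn
  have hmem : ∀ {u v : g}, u ∈ h → v ∈ h → leviCivita B u v ∈ h :=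
    fun hu hv => hA.leviCivita_mem hC hB hα hu hv
  have hnull := fun {v : g} (hv : v ∈ h) => hA.leviCivita_null hC hB hα hv
  let k : LieSubalgebra ℝ g :=
    { h with
      lie_mem' := fun {u v} hu hv => by
        rw [← tor u v]
        exact h.sub_mem (hmem hu hv) (hmem hv hu) }
  let φ : Module.Dual ℝ g := B.flip e ∘ₗ (leviCivita B).flip e'
  have hφ : ∀ v, φ v = B (leviCivita B v e') e := fun v => rfl
  have H : IsNullSplitting B e e' k.toSubmodule := hA.toIsNullSplitting
  let X : k := H.proj (sharp B φ)
  have hX : ∀ v ∈ h, B (X : g) v = φ v := fun v hv => by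
    rw [← apply_sharp hn φ v]
    exact H.apply_proj hs _ hv
  have hX0 : X ≠ 0 := fun h0 => by
    have hφ0 : ∀ v ∈ h, φ v = 0 := fun v hv => by rw [← hX v hv, h0]; simp
    have hpar : ∀ w, ∀ v ∈ h, B (leviCivita B w e') v = 0 := fun w v hv => by
      rw [H.decomp hs w]
      have h1 : B (leviCivita B (H.proj w : g) e') v = 0 := by
        rw [sk, (H.orthogonal _ (hmem (H.proj w).2 hv)).2, neg_zero]
      have h2 := (hnull hv).2.2.2
      rw [← hφ, hφ0 v hv, mul_zero] at h2
      simp [h1, (hnull hv).2.2.1, (mul_eq_zero.mp h2).resolve_left hα']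
    have h1 : ricciForm B e' e' = 0 := ricciForm_self_of_recurrent (φ := φ) fun w => by
      refine H.ext hs ?_ ?_ fun v hv => ?_
      · simp [hφ, hs.eq e' e, H.pairing]
      · simp [sk0, H.null_right]
      · simp [hpar w v hv, (H.orthogonal v hv).2]
    rw [← apply_ricci hn, hA.map_right] at h1
    simp only [map_add, map_smul, LinearMap.add_apply, LinearMap.smul_apply, H.pairing,
      H.null_right, smul_eq_mul] at h1
    rcases hA.sign with h2 | h2 <;> rw [h2] at h1 <;> norm_num at h1
  let D : Module.End ℝ k := H.proj ∘ₗ (LieAlgebra.ad ℝ g e : g →ₗ[ℝ] g) ∘ₗ k.toSubmodule.subtype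
  let D' : Module.End ℝ k := H.proj ∘ₗ (LieAlgebra.ad ℝ g e' : g →ₗ[ℝ] g) ∘ₗ k.toSubmodule.subtype
  have hDa : ∀ u v : k, B (D u) v = B ⁅e, (u : g)⁆ v := fun u v => H.apply_proj hs _ v.2
  have hDa' : ∀ u v : k, B (D' u) v = B ⁅e', (u : g)⁆ v := fun u v => H.apply_proj hs _ v.2
  have hL : ∀ u v : k, B (leviCivita B (u : g) e) v = 0 ∧ B (leviCivita B (u : g) e') v = 0 :=
    fun u v => by
      rw [sk, sk _ e']
      simp [H.orthogonal _ (hmem u.2 v.2)]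
  refine ⟨k, X, rfl, hX0, H.isNullSemidirect (q := B (leviCivita B e' e) e') (D := D) (D' := D')
    hs X hX0 (fun v => ?_) (fun v => ?_) ?_ (fun u v => ?_) fun u v => ?_⟩
  · have h1 := H.decomp hs ⁅e, (v : g)⁆
    have h2 : B e ⁅e, (v : g)⁆ = 0 := by
      rw [hs.eq, ← tor, map_sub, LinearMap.sub_apply, sk0, sk, hs.eq,
        (hnull v.2).1]
      simp
    have h3 : B e' ⁅e, (v : g)⁆ = B X v := by
      rw [hs.eq, ← tor, map_sub, LinearMap.sub_apply, sk, sk _ e, hs.eq, (hnull v.2).2.2.1,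
        hX v v.2, hφ, hs.eq e]
      simp
    rw [h2, h3, zero_smul, add_zero, add_comm] at h1
    exact h1
  · have h1 := H.decomp hs ⁅e', (v : g)⁆
    have h2 : B e ⁅e', (v : g)⁆ = -B X v := by
      rw [hs.eq, ← tor, map_sub, LinearMap.sub_apply, sk, hs.eq,
        (hnull v.2).2.1, hX v v.2, hφ]
      simp
    have h3 : B e' ⁅e', (v : g)⁆ = -(2 * ε / (α - a) * B X v) := by
      have h4 := (hnull v.2).2.2.2
      rw [hs.eq, ← tor, map_sub, LinearMap.sub_apply, sk0, sk, hs.eq, hX v v.2, hφ]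
      field_simp
      linear_combination -h4
    rw [h2, h3] at h1
    rw [h1]
    change _ = (H.proj ⁅e', (v : g)⁆ : g) - _
    module
  · have h1 := hA.leviCivita_left_left hC hB
    rw [← tor]
    have h3 : leviCivita B e e' = 0 := H.ext hs (by simpa using h1) (by simp [sk0])
      fun v hv => by simp [(hnull hv).2.2.1]
    have h4 : leviCivita B e' e = B (leviCivita B e' e) e' • e :=
      H.ext hs (by simp [sk0, H.null_left]) (by simp [H.pairing])
        fun v hv => by simp [(hnull hv).2.1, (H.orthogonal v hv).1]
    rw [h3, zero_sub, ← h4]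
  · rw [hDa, hs.eq (u : g), hDa, ← tor, ← tor, map_sub, map_sub, LinearMap.sub_apply,
      LinearMap.sub_apply, (hL u v).1, (hL v u).1, sk, hs.eq]
    simp
  · rw [hDa', hs.eq (u : g), hDa', ← tor, ← tor, map_sub, map_sub, LinearMap.sub_apply,
      LinearMap.sub_apply, (hL u v).2, (hL v u).2, sk, hs.eq]
    simp

/-- The Einstein constant of `k` is nonpositive by Milnor's inequality at `X`. -/
lemma IsNullSemidirect.einstein_nonpos {c : ℝ} {k : LieSubalgebra ℝ g} {X : k} (hX : X ≠ 0)
    (H : IsNullSemidirect B c X e e' k) (hs : B.IsSymm)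
    (hE : IsEinstein (restrictForm B k) α) : α ≤ 0 := by
  have hEu : IsEuclidean (restrictForm B k) := H.splitting.euclidean
  have h1 := hEu.ricciForm_self_nonpos (X := X) fun u v => H.apply_lie hs u v
  rw [← apply_ricci hEu.nondegenerate, hE] at h1
  simp only [LinearMap.smul_apply, LinearMap.id_apply, map_smul, smul_eq_mul] at h1
  exact nonpos_of_mul_nonpos_left h1 (hEu.2 X hX)

lemma IsTypeA2.ricci_data (hA : IsTypeA2 B (ricci B) a α ε e e' h) (hB : IsLorentzian B)
    {k : LieSubalgebra ℝ g} (hk : k.toSubmodule = h) {c : ℝ} {X : k}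
    (H : IsNullSemidirect B c X e e' k) :
    a = 0 ∧ IsEinstein (restrictForm B k) α ∧
      ε = -(c * (2 * B X X + LinearMap.trace ℝ k (LieAlgebra.ad ℝ k X))) := by
  have hn := hB.nondegenerate
  refine ⟨?_, ?_, ?_⟩
  · have h1 := H.ricciForm_left hB e'
    rw [← apply_ricci hn, hA.map_left] at h1
    simpa [hA.pairing] using h1
  · refine LinearMap.ext fun u => ?_
    rw [← sub_eq_zero]
    refine H.restrict_nondegenerate.1 _ fun v => ?_
    have h1 := apply_ricci H.restrict_nondegenerate u v
    rw [← H.ricciForm_coe_coe hB, ← apply_ricci hn, hA.map_diag u (hk ▸ u.2)] at h1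
    rw [map_sub, LinearMap.sub_apply, h1]
    simp [restrictForm]
  · have h1 := H.ricciForm_right_right hB
    rw [← apply_ricci hn, hA.map_right] at h1
    simpa [hA.pairing, hA.null_right] using h1

/-- On the null semidirect product with `c = 2ε/α` and Einstein subalgebra `k`, the Ricci operator
vanishes on `e`, sends `e'` to `ε e`, and is `α • id` on `k`; the choice of `c` makes it a Codazzi
operator. -/
lemma IsNullSemidirect.hasHarmonicCurvature {k : LieSubalgebra ℝ g} {X : k}
    (H : IsNullSemidirect B (2 * ε / α) X e e' k) (hB : IsLorentzian B) (hα : α ≠ 0)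
    (hsymm : ∀ u v, B (ricci B u) v = B u (ricci B v)) (hE : IsEinstein (restrictForm B k) α)
    (htr : α = -4 * B X X - 2 * LinearMap.trace ℝ k (LieAlgebra.ad ℝ k X)) :
    HasHarmonicCurvature B := by
  have hs := hB.1
  have hn := hB.nondegenerate
  have HS := H.splitting
  have hcα : 2 * ε / α * α = 2 * ε := div_mul_cancel₀ _ hα
  have r1 : ricci B e = 0 := hn.1 _ fun w => by rw [apply_ricci hn, H.ricciForm_left hB]
  have r2 : ricci B e' = ε • e := by
    refine HS.ext hs ?_ ?_ fun v hv => ?_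
    · rw [hsymm, r1]
      simp [HS.null_left]
    · rw [apply_ricci hn, H.ricciForm_right_right hB]
      simp only [map_smul, LinearMap.smul_apply, HS.pairing, smul_eq_mul]
      change -(2 * ε / α * (2 * B X X + LinearMap.trace ℝ k (LieAlgebra.ad ℝ k X))) = _
      have : 2 * B (X : g) X + LinearMap.trace ℝ k (LieAlgebra.ad ℝ k X) = -α / 2 := by linarith
      rw [this]
      field_simp
    · rw [apply_ricci hn, H.ricciForm_right_coe hB hv]
      simp [(HS.orthogonal v hv).1]
  have r3 : ∀ v : k, ricci B (v : g) = α • (v : g) := fun v => by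
    have hv := HS.orthogonal v v.2
    refine HS.ext hs ?_ ?_ fun w hw => ?_
    · rw [hsymm, r1, map_smul, LinearMap.smul_apply, hs.eq _ e, hv.1]
      simp
    · rw [hsymm, r2, map_smul, map_smul, LinearMap.smul_apply, hs.eq _ e, hv.1, hs.eq _ e', hv.2]
      simp
    · rw [apply_ricci hn, H.ricciForm_coe_coe hB v ⟨w, hw⟩, ← apply_ricci H.restrict_nondegenerate,
        hE]
      simp [restrictForm]
  have r : ∀ w, ricci B w =
      α • w - α • (B e' w • e + B e w • e') + (ε * B e w) • e := fun w => by
    have h1 := HS.decomp hs w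
    have h2 : (HS.proj w : g) = w - (B e' w • e + B e w • e') := by
      rw [eq_sub_iff_add_eq, add_comm]
      exact h1.symm
    conv_lhs => rw [h1]
    rw [map_add, map_add, map_smul, map_smul, r1, r2, r3 (HS.proj w), h2]
    module
  refine ⟨hsymm, fun u v w => ?_⟩
  have sk := leviCivita_skew hn hs
  -- `sk1` cancels the contribution of `α • w`, and `α c = 2 ε` balances the rest
  have sk1 : ∀ u v w, B (leviCivita B u v) w + B (leviCivita B u w) v = 0 := fun u v w => by
    rw [sk, hs.eq v]
    ring
  have k1 : ∀ u v, B (leviCivita B u v) e = B X u * B e v := fun u v => by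
    rw [sk, H.leviCivita_apply_left hB, map_neg, map_smul, neg_neg, hs.eq v, smul_eq_mul]
  have k2 : ∀ u v, B (leviCivita B u v) e' =
      -(B X u * B e' v + 2 * ε / α * B e u * B X v) := fun u v => by
    rw [sk, H.leviCivita_apply_right hB, map_add, map_smul, map_smul, hs.eq v, hs.eq v]
    simp only [smul_eq_mul]
  have h1 := sk1 u v w
  have h2 := sk1 v u w
  simp only [r, map_add, map_sub, map_smul, smul_eq_mul, k1, k2]
  linear_combination α * h1 - α * h2 +
    (B e u * B X v * B e w - B e v * B X u * B e w) * hcα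

namespace IsA2Model

variable {k : LieSubalgebra ℝ g}

/-- The displayed brackets with `k` determine those of every element, by splitting off its
component along `X`. -/
lemma exists_isNullSemidirect (hM : IsA2Model B α ε e e' k) :
    ∃ X : k, IsNullSemidirect B (2 * ε / α) X e e' k ∧
      α = -4 * B X X - 2 * LinearMap.trace ℝ k (LieAlgebra.ad ℝ k X) := by
  obtain ⟨X, hX0, -, h1, h2, h3, h4⟩ := hM.brackets
  obtain ⟨I, hI, hab⟩ := hM.ideal
  have hpos : B (X : g) X ≠ 0 := (hM.splitting.euclidean.2 X hX0).ne'
  have split : ∀ u ∈ k, ∃ v ∈ k, u = (B (X : g) u / B (X : g) X) • (X : g) + v ∧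
      ⁅e, v⁆ = 0 ∧ ⁅e', v⁆ = 0 := fun u hu => by
    have hv := k.sub_mem hu (k.smul_mem (B (X : g) u / B (X : g) X) X.2)
    refine ⟨_, hv, by abel, h1 ⟨_, hv⟩ ?_⟩
    change B (X : g) (u - (B (X : g) u / B (X : g) X) • (X : g)) = 0
    rw [map_sub, map_smul, smul_eq_mul, div_mul_cancel₀ _ hpos, sub_self]
  refine ⟨X, ⟨hM.splitting, X.2, ?_, fun u hu => ?_, fun u hu => ?_⟩, h4⟩
  · have he : e ∈ I := by
      rw [← LieSubmodule.mem_toSubmodule, hI]; exact Submodule.subset_span (by simp)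
    have he' : e' ∈ I := by
      rw [← LieSubmodule.mem_toSubmodule, hI]; exact Submodule.subset_span (by simp)
    exact congrArg Subtype.val (hab.trivial ⟨e, he⟩ ⟨e', he'⟩)
  · obtain ⟨v, -, huv, hv, -⟩ := split u hu
    conv_lhs => rw [huv]
    rw [lie_add, lie_smul, hv, h2, smul_smul, div_mul_cancel₀ _ hpos, add_zero]
  · obtain ⟨v, -, huv, -, hv⟩ := split u hu
    conv_lhs => rw [huv]
    rw [lie_add, lie_smul, hv, h3, smul_neg, smul_smul, div_mul_cancel₀ _ hpos, add_zero]

end IsA2Model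

lemma IsNullSemidirect.isA2Model {k : LieSubalgebra ℝ g} {X : k} (hX : X ≠ 0)
    (H : IsNullSemidirect B (2 * ε / α) X e e' k) (hs : B.IsSymm)
    (hE : IsEinstein (restrictForm B k) α)
    (htr : α = -4 * B X X - 2 * LinearMap.trace ℝ k (LieAlgebra.ad ℝ k X)) :
    IsA2Model B α ε e e' k := by
  have he : e ∈ Submodule.span ℝ {e, e'} := Submodule.subset_span (by simp)
  have he' : e' ∈ Submodule.span ℝ {e, e'} := Submodule.subset_span (by simp)
  refine ⟨H.splitting, ⟨{ Submodule.span ℝ {e, e'} with lie_mem := fun {x m} hm => ?_ }, rfl,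
    ⟨fun x y => Subtype.ext ?_⟩⟩, hE, X, hX, fun u v => H.apply_lie hs u v, fun u hu => ?_,
    H.left_lie hs _, H.right_lie hs _, htr⟩
  · obtain ⟨s, t, rfl⟩ := Submodule.mem_span_pair.mp hm
    change ⁅x, s • e + t • e'⁆ ∈ Submodule.span ℝ {e, e'}
    rw [lie_add, lie_smul, lie_smul, H.lie_left' hs, H.lie_right' hs]
    exact add_mem (Submodule.smul_mem _ _ (neg_mem (Submodule.smul_mem _ _ he)))
      (Submodule.smul_mem _ _ (Submodule.smul_mem _ _ (add_mem (Submodule.smul_mem _ _ he) he')))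
  · obtain ⟨s, t, hx⟩ := Submodule.mem_span_pair.mp x.2
    obtain ⟨s', t', hy⟩ := Submodule.mem_span_pair.mp y.2
    change ⁅(x : g), (y : g)⁆ = 0
    rw [← hx, ← hy]
    simp [H.left_lie hs, H.right_lie hs, H.apply_left hs, H.apply_right hs]
  · have hu' : B (X : g) u = 0 := hu
    rw [H.left_lie hs, H.right_lie hs, hu']
    simp

end Equivalence

end LorentzLie

theorem theorem5p1 {g : Type*} [LieRing g] [LieAlgebra ℝ g] [FiniteDimensional ℝ g]
    (B : LinearMap.BilinForm ℝ g) (hB : LorentzLie.IsLorentzian B)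
    (a α ε : ℝ) (e e' : g) (h : Submodule ℝ g)
    (hRic : LorentzLie.IsTypeA2 B (LorentzLie.ricci B) a α ε e e' h) (hα : α ≠ a) :
    (LorentzLie.HasHarmonicCurvature B ↔
      a = 0 ∧ α < 0 ∧
        ∃ k : LieSubalgebra ℝ g, k.toSubmodule = h ∧ LorentzLie.IsA2Model B α ε e e' k) ∧
    (LorentzLie.HasHarmonicCurvature B ↔
      a = 0 ∧ α < 0 ∧
        ∃ (f f' : g) (k : LieSubalgebra ℝ g), LorentzLie.IsA2Model B α ε f f' k) ∧
    ¬ LorentzLie.IsRicciParallel B := by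
  have hs := hB.1
  have hn := hB.nondegenerate
  have hε : ε ≠ 0 := by rcases hRic.sign with h | h <;> rw [h] <;> norm_num
  have hsymm : ∀ u v, B (LorentzLie.ricci B u) v = B u (LorentzLie.ricci B v) := hRic.map_symm hs
  have structure_of : LorentzLie.HasHarmonicCurvature B →
      a = 0 ∧ ∃ (k : LieSubalgebra ℝ g) (X : k), k.toSubmodule = h ∧ X ≠ 0 ∧
        LorentzLie.IsNullSemidirect B (2 * ε / α) X e e' k ∧
        LorentzLie.IsEinstein (LorentzLie.restrictForm B k) α ∧
        ε = -(2 * ε / α * (2 * B X X + LinearMap.trace ℝ k (LieAlgebra.ad ℝ k X))) := by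
    intro hC
    obtain ⟨k, X, hk, hX, H⟩ := hRic.exists_isNullSemidirect hC hB hα
    obtain ⟨ha, hE, hε'⟩ := hRic.ricci_data hB hk H
    rw [ha, sub_zero] at H hε'
    exact ⟨ha, k, X, hk, hX, H, hE, hε'⟩
  have forward : LorentzLie.HasHarmonicCurvature B → a = 0 ∧ α < 0 ∧
      ∃ k : LieSubalgebra ℝ g, k.toSubmodule = h ∧ LorentzLie.IsA2Model B α ε e e' k := by
    intro hC
    obtain ⟨ha, k, X, hk, hX, H, hE, hε'⟩ := structure_of hC
    rw [ha] at hα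
    refine ⟨ha, lt_of_le_of_ne (H.einstein_nonpos hX hs hE) hα, k, hk, H.isA2Model hX hs hE ?_⟩
    field_simp at hε'
    linarith
  have backward : (a = 0 ∧ α < 0 ∧
      ∃ (f f' : g) (k : LieSubalgebra ℝ g), LorentzLie.IsA2Model B α ε f f' k) →
      LorentzLie.HasHarmonicCurvature B := by
    rintro ⟨-, hneg, f, f', k, hM⟩
    obtain ⟨X, H, htr⟩ := hM.exists_isNullSemidirect
    exact H.hasHarmonicCurvature hB hneg.ne hsymm hM.einstein htr
  refine ⟨⟨forward, fun ⟨ha, hneg, k, _, hM⟩ => backward ⟨ha, hneg, e, e', k, hM⟩⟩,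
    ⟨fun hC => ?_, backward⟩, fun hP => ?_⟩
  · obtain ⟨ha, hneg, k, -, hM⟩ := forward hC
    exact ⟨ha, hneg, e, e', k, hM⟩
  · have hC : LorentzLie.HasHarmonicCurvature B := by
      -- both sides of the Codazzi equation vanish for a parallel symmetric operator
      have key : ∀ u v w, B (LorentzLie.leviCivita B u v) (LorentzLie.ricci B w) +
          B (LorentzLie.leviCivita B u w) (LorentzLie.ricci B v) = 0 := fun u v w => by
        rw [← hsymm, ← hP, LorentzLie.leviCivita_skew hn hs, hs.eq]
        ring
      exact ⟨hsymm, fun u v w => by rw [key, key]⟩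
    obtain ⟨ha, k, X, hk, hX, H, -, -⟩ := structure_of hC
    have hpos := H.splitting.euclidean.2 X hX
    -- `∇_X e = -|X|² e` and `∇_X e' = |X|² e'`, so `(∇_X Ric) e' = -2 ε |X|² e`
    have h1 := hP X e'
    rw [hRic.map_right, ha, zero_smul, add_zero, map_smul, H.leviCivita_apply_left hB,
      H.leviCivita_apply_right hB, (H.splitting.orthogonal X X.2).1, mul_zero, zero_smul, add_zero,
      map_smul, hRic.map_right, ha, zero_smul, add_zero] at h1
    have h2 := congrArg (fun x => B x e') h1
    simp only [map_smul, map_neg, LinearMap.smul_apply, LinearMap.neg_apply, H.splitting.pairing,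
      smul_eq_mul] at h2
    exact mul_ne_zero hε hpos.ne' (by change ε * B (X : g) X = 0; linarith)
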